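/- Let $0<\alpha<1$ and $0\le a<\alpha$. Let $\tau>0$ be a random variable with $\mathbb P(\tau>u)=u^{-\alpha}L(u)$, $u>0$, where $L$ is slowly varying at infinity, and let $\mathbb E\tau^a$ be the mean of $\tau^a$. Let $\gamma_1,\gamma_2,\dots\in(0,\infty)$, defined on a probability space $(\Omega,\mathcal F,\mathbf P)$, be the marks of a Poisson random measure $\sum_k\delta_{\gamma_k}$ on $(0,\infty)$ whose intensity measure $\mu$ is given by $\mu(x,\infty)=x^{-\alpha}$, $x>0$. Let $\nu^{ext,-}$ be the random measure on $(0,\infty)$ with tail $$\nu^{ext,-}(u,\infty)=\frac1{\mathbb E\tau^a}\sum_k\gamma_k^a\,e^{-u\gamma_k^{-(1-a)}},\qquad u>0 .$$ Then $\mathbb E\tau^a<\infty$ and, $\mathbf P$-almost surely, $\nu^{ext,-}(u,\infty)<\infty$ for all $u>0$ and $$\nu^{ext,-}(u,\infty)\sim \frac{1}{\mathbb E\tau^a}\,u^{-\frac{\alpha-a}{1-a}}\,\frac{\alpha}{1-a}\,\Gamma\Bigl(\frac{\alpha-a}{1-a}\Bigr),\qquad u\to0^+ .$$ In particular, $\mathbf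 P$-almost surely, $u\mapsto\nu^{ext,-}(u,\infty)$ is regularly varying at $0^+$: for every $c>0$, $\nu^{ext,-}(cu,\infty)/\nu^{ext,-}(u,\infty)\to c^{-\frac{\alpha-a}{1-a}}$ as $u\to0^+$. -/

import Mathlib

open MeasureTheory ProbabilityTheory Filter Topology Set
open scoped ENNReal NNReal

noncomputable section

/-- `L` is slowly varying at infinity. -/
def SlowlyVarying (L : ℝ → ℝ) : Prop :=
  Measurable L ∧ (∀ᶠ x in atTop, 0 < L x) ∧
    ∀ c : ℝ, 0 < c → Tendsto (fun x => L (c * x) / L x) atTop (𝓝 1)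

/-- The class of laws on `ℝ` with tail `u ^ (-α) * L u`, `L` slowly varying at infinity. -/
def InStableDomain (α : ℝ) (law : Measure ℝ) : Prop :=
  ∃ L : ℝ → ℝ, SlowlyVarying L ∧ ∀ u : ℝ, 0 < u → law.real (Ioi u) = u ^ (-α) * L u

/-- The measure `μ` on `(0, ∞)` with tail `μ (x, ∞) = x ^ (-α)`, as a measure on `ℝ` carried
by `(0, ∞)`. -/
def stableIntensity (α : ℝ) : Measure ℝ :=
  (volume.restrict (Ioi 0)).withDensity fun x => ENNReal.ofReal (α * x ^ (-α - 1))

theorem stableIntensity_Ioi {α x : ℝ} (hα : 0 < α) (hx : 0 < x) :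
    stableIntensity α (Ioi x) = ENNReal.ofReal (x ^ (-α)) := by
  rw [stableIntensity, withDensity_apply _ measurableSet_Ioi,
    Measure.restrict_restrict measurableSet_Ioi,
    inter_eq_left.mpr (Ioi_subset_Ioi hx.le), ← ofReal_integral_eq_lintegral_ofReal]
  · rw [integral_const_mul, integral_Ioi_rpow_of_lt (by linarith) hx]
    congr 1
    rw [sub_add_cancel]
    field_simp
  · exact (integrableOn_Ioi_rpow_of_lt (by linarith) hx).const_mul α
  · refine (ae_restrict_iff' measurableSet_Ioi).mpr (Eventually.of_forall fun y hy => ?_)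
    exact mul_nonneg hα.le (Real.rpow_nonneg (hx.trans hy).le _)

/-- The point measure `∑ₖ δ_{γₖ}`. -/
def pointMeasure (x : ℕ → ℝ) : Measure ℝ :=
  Measure.sum fun k => Measure.dirac (x k)

/-- `N` is a Poisson random measure on `E` with intensity measure `m`, under `P`. -/
structure IsPoissonRandomMeasure {Ω E : Type*} [MeasurableSpace Ω] [MeasurableSpace E]
    (N : Ω → Measure E) (m : Measure E) (P : Measure Ω) : Prop where
  measurable_apply : ∀ B, MeasurableSet B → Measurable fun ω => N ω B
  law_of_finite : ∀ B, MeasurableSet B → m B ≠ ∞ →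
    P.map (fun ω => N ω B) =
      (poissonMeasure (m B).toNNReal).map (fun k : ℕ => (k : ℝ≥0∞))
  eq_top_of_infinite : ∀ B, MeasurableSet B → m B = ∞ → ∀ᵐ ω ∂P, N ω B = ∞
  indep : ∀ (n : ℕ) (B : Fin n → Set E), (∀ i, MeasurableSet (B i)) →
    Pairwise (fun i j => Disjoint (B i) (B j)) →
    iIndepFun (fun i ω => N ω (B i)) P

/-- For points `xₖ > 0` and a constant `M > 0` (to be `E τ ^ a`), the measure on `(0, ∞)` with tail
`u ↦ (1 / M) * ∑ₖ xₖ ^ a * exp (-u * xₖ ^ (-(1 - a)))`: a mixture of exponential laws with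
rates `xₖ ^ (-(1 - a))`. -/
def extLevyMeasure (a M : ℝ) (x : ℕ → ℝ) : Measure ℝ :=
  ENNReal.ofReal (1 / M) •
    Measure.sum fun k => ENNReal.ofReal (x k ^ a) • expMeasure (x k ^ (-(1 - a)))

theorem expMeasure_Ioi {r u : ℝ} (hr : 0 < r) (hu : 0 ≤ u) :
    expMeasure r (Ioi u) = ENNReal.ofReal (Real.exp (-(r * u))) := by
  have := isProbabilityMeasure_expMeasure hr
  have h := cdf_expMeasure_eq hr u
  rw [if_pos hu, cdf_eq_real] at h
  have h2 : (expMeasure r).real (Ioi u) = Real.exp (-(r * u)) := by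
    rw [← compl_Iic, probReal_compl_eq_one_sub measurableSet_Iic, h]; ring
  rw [← h2, ofReal_measureReal]

/-- The tail of `extLevyMeasure`. -/
theorem extLevyMeasure_Ioi {a M u : ℝ} {x : ℕ → ℝ} (hx : ∀ k, 0 < x k) (hu : 0 ≤ u) :
    extLevyMeasure a M x (Ioi u) = ENNReal.ofReal (1 / M) *
      ∑' k, ENNReal.ofReal (x k ^ a * Real.exp (-u * x k ^ (-(1 - a)))) := by
  rw [extLevyMeasure, Measure.smul_apply, Measure.sum_apply _ measurableSet_Ioi, smul_eq_mul]
  congr 1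
  refine tsum_congr fun k => ?_
  rw [Measure.smul_apply, expMeasure_Ioi (Real.rpow_pos_of_pos (hx k) _) hu, smul_eq_mul,
    ← ENNReal.ofReal_mul (Real.rpow_nonneg (hx k).le _)]
  congr 3
  ring

/-- A measure of the above form is carried by `(0, ∞)`. -/
theorem extLevyMeasure_Iic {a M : ℝ} {x : ℕ → ℝ} (hx : ∀ k, 0 < x k) :
    extLevyMeasure a M x (Iic 0) = 0 := by
  rw [extLevyMeasure, Measure.smul_apply, Measure.sum_apply _ measurableSet_Iic, smul_eq_mul]
  have h : ∀ k, (ENNReal.ofReal (x k ^ a) • expMeasure (x k ^ (-(1 - a)))) (Iic (0 : ℝ)) = 0 := by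
    intro k
    have hr := Real.rpow_pos_of_pos (hx k) (-(1 - a))
    have := isProbabilityMeasure_expMeasure hr
    have h := cdf_expMeasure_eq hr 0
    rw [if_pos le_rfl, cdf_eq_real] at h
    have h0 : expMeasure (x k ^ (-(1 - a))) (Iic 0) = 0 := by
      rw [← ofReal_measureReal, h]; simp
    rw [Measure.smul_apply, h0, smul_zero]
  rw [ENNReal.tsum_eq_zero.mpr h, mul_zero]

end

/-! Write N for the point measure of the marks. The tail at u is (1/𝔼τ^a) ∫ h_u dN with h_u(x) = x^a
exp(-u x^{-(1-a)}), and the claim is that N may be replaced by its mean μ as u → 0. Almost surely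
N(x,∞) ~ x^{-α} as x → 0: Chebyshev and Borel–Cantelli give this along levels with mean n², and
monotonicity of the count fills the gaps (`IsPoissonRandomMeasure.ae_tendsto_tail`). The rest is
deterministic. As a ≥ 0 and a < 1, h_u is nondecreasing, so inequalities between tails pass to
integrals (`setLIntegral_Ioi_mono_of_tail_le`). Near 0 the tails of N lie between (1 ± ε) times
those of μ; away from 0 the discrepancy costs a constant independent of u, because h_u(x) ≤ x^a.
Finally ∫ h_u dμ is a Gamma integral of order u^{-(α-a)/(1-a)}, which diverges and absorbs these
constants. The moment of τ is finite because its tail decays geometrically along doublings, at a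
rate that beats 2^a. -/

/-! ### Finiteness of the moment of τ -/

/-- A Potter-type bound using slow variation at the single ratio 2: eventually L(2x) ≤ 2^{α-b} L(x),
so each doubling multiplies the tail by at most 2^{-b}. -/
theorem InStableDomain.exists_tail_le_geometric {α b : ℝ} {law : Measure ℝ}
    [IsFiniteMeasure law] (h : InStableDomain α law) (hb : b < α) :
    ∃ X : ℝ, 0 < X ∧ ∀ n : ℕ,
      law.real (Ioi (2 ^ n * X)) ≤ law.real (Ioi X) * ((2 : ℝ) ^ (-b)) ^ n := by
  obtain ⟨L, ⟨-, hpos, hL⟩, htail⟩ := h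
  have hratio : (1 : ℝ) < 2 ^ (α - b) := Real.one_lt_rpow one_lt_two (by linarith)
  have hev := (hL 2 two_pos).eventually_lt_const hratio
  obtain ⟨X, hX⟩ := eventually_atTop.1 ((hpos.and hev).and (eventually_gt_atTop (0 : ℝ)))
  have hX0 : 0 < X := (hX X le_rfl).2
  have step : ∀ x, X ≤ x → law.real (Ioi (2 * x)) ≤ law.real (Ioi x) * 2 ^ (-b) := by
    intro x hx
    obtain ⟨⟨hLx, hlt⟩, hx0⟩ := hX x hx
    rw [htail x hx0, htail (2 * x) (by positivity), Real.mul_rpow two_pos.le hx0.le]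
    have h1 : L (2 * x) ≤ 2 ^ (α - b) * L x := ((div_lt_iff₀ hLx).1 hlt).le
    calc (2 : ℝ) ^ (-α) * x ^ (-α) * L (2 * x)
        ≤ 2 ^ (-α) * x ^ (-α) * (2 ^ (α - b) * L x) := by gcongr
      _ = x ^ (-α) * L x * (2 ^ (-α) * 2 ^ (α - b)) := by ring
      _ = x ^ (-α) * L x * 2 ^ (-b) := by
        rw [← Real.rpow_add two_pos]; congr 2; ring
  refine ⟨X, hX0, fun n => ?_⟩
  induction n with
  | zero => simp
  | succ n ih =>
    have hle : X ≤ 2 ^ n * X := le_mul_of_one_le_left hX0.le (one_le_pow₀ one_le_two)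
    calc law.real (Ioi (2 ^ (n + 1) * X)) = law.real (Ioi (2 * (2 ^ n * X))) := by
          rw [pow_succ', mul_assoc]
      _ ≤ law.real (Ioi (2 ^ n * X)) * 2 ^ (-b) := step _ hle
      _ ≤ law.real (Ioi X) * ((2 : ℝ) ^ (-b)) ^ n * 2 ^ (-b) := by gcongr
      _ = _ := by rw [pow_succ, mul_assoc]

theorem ofReal_rpow_le_dyadic_sum {a X t : ℝ} (ha : 0 ≤ a) (hX : 0 < X) (ht : 0 < t) :
    ENNReal.ofReal (t ^ a) ≤ ENNReal.ofReal ((2 * X) ^ a) +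
      ∑' n : ℕ, (Ioi (2 ^ n * X)).indicator
        (fun _ => ENNReal.ofReal ((2 ^ (n + 2) * X) ^ a)) t := by
  rcases le_total t (2 * X) with h | h
  · exact le_add_right (ENNReal.ofReal_le_ofReal (Real.rpow_le_rpow ht.le h ha))
  · have h1 : 1 ≤ t / (2 * X) := (one_le_div (by positivity)).2 h
    -- Dividing by 2X rather than X gives 2^{n+1}X ≤ t < 2^{n+2}X, so t lies strictly inside the
    -- open half-line of index n.
    obtain ⟨n, hn, hn'⟩ := exists_nat_pow_near h1 one_lt_two
    rw [le_div_iff₀ (by positivity)] at hn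
    rw [div_lt_iff₀ (by positivity)] at hn'
    refine le_add_left (le_trans ?_ (ENNReal.le_tsum n))
    have hp : 0 < 2 ^ n * X := by positivity
    rw [indicator_of_mem (by rw [mem_Ioi]; nlinarith)]
    refine ENNReal.ofReal_le_ofReal (Real.rpow_le_rpow ht.le (hn'.le.trans (le_of_eq ?_)) ha)
    ring

theorem InStableDomain.integrable_rpow {Ω' : Type*} [MeasurableSpace Ω'] {Q : Measure Ω'}
    [IsProbabilityMeasure Q] {α a : ℝ} (ha0 : 0 ≤ a) (haα : a < α)
    {τ : Ω' → ℝ} (hτm : Measurable τ) (hτpos : ∀ ω, 0 < τ ω)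
    (hτ : InStableDomain α (Q.map τ)) : Integrable (fun ω => τ ω ^ a) Q := by
  have := Measure.isProbabilityMeasure_map (μ := Q) hτm.aemeasurable
  -- Any b strictly between a and α works: the dyadic series then has ratio 2^{a-b} < 1.
  obtain ⟨X, hX, hG⟩ := hτ.exists_tail_le_geometric (b := (a + α) / 2) (by linarith)
  refine ⟨(hτm.pow_const a).aestronglyMeasurable, ?_⟩
  rw [hasFiniteIntegral_iff_ofReal (ae_of_all _ fun ω => Real.rpow_nonneg (hτpos ω).le a)]
  set q : ℝ := 2 ^ a * 2 ^ (-((a + α) / 2)) with hq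
  have hq0 : 0 ≤ q := by positivity
  have hq1 : q < 1 := by
    rw [hq, ← Real.rpow_add two_pos]
    exact Real.rpow_lt_one_of_one_lt_of_neg one_lt_two (by linarith)
  have hterm : ∀ n : ℕ, ENNReal.ofReal ((2 ^ (n + 2) * X) ^ a) * Q.map τ (Ioi (2 ^ n * X)) ≤
      ENNReal.ofReal ((4 * X) ^ a * (Q.map τ).real (Ioi X) * q ^ n) := by
    intro n
    rw [← ofReal_measureReal, ← ENNReal.ofReal_mul (by positivity)]
    refine ENNReal.ofReal_le_ofReal ?_
    have e : ((2 : ℝ) ^ (n + 2) * X) ^ a = (4 * X) ^ a * ((2 : ℝ) ^ a) ^ n := by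
      rw [show (2 : ℝ) ^ (n + 2) * X = (4 * X) * 2 ^ n by ring,
        Real.mul_rpow (by positivity) (by positivity), ← Real.rpow_natCast, ← Real.rpow_natCast,
        ← Real.rpow_mul two_pos.le, ← Real.rpow_mul two_pos.le, mul_comm a]
    rw [e, hq, mul_pow]
    calc _ ≤ (4 * X) ^ a * ((2 : ℝ) ^ a) ^ n *
          ((Q.map τ).real (Ioi X) * ((2 : ℝ) ^ (-((a + α) / 2))) ^ n) := by gcongr; exact hG n
      _ = _ := by ring
  calc ∫⁻ ω, ENNReal.ofReal (τ ω ^ a) ∂Q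
      ≤ ∫⁻ ω, (ENNReal.ofReal ((2 * X) ^ a) + ∑' n : ℕ, (Ioi (2 ^ n * X)).indicator
        (fun _ => ENNReal.ofReal ((2 ^ (n + 2) * X) ^ a)) (τ ω)) ∂Q :=
        lintegral_mono fun ω => ofReal_rpow_le_dyadic_sum ha0 hX (hτpos ω)
    _ = ENNReal.ofReal ((2 * X) ^ a) + ∑' n : ℕ,
        ENNReal.ofReal ((2 ^ (n + 2) * X) ^ a) * Q.map τ (Ioi (2 ^ n * X)) := by
      rw [lintegral_add_left measurable_const, lintegral_const, measure_univ, mul_one,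
        lintegral_tsum (f := fun (n : ℕ) ω => (Ioi (2 ^ n * X)).indicator
          (fun _ => ENNReal.ofReal ((2 ^ (n + 2) * X) ^ a)) (τ ω)) fun n =>
          ((measurable_const.indicator measurableSet_Ioi).comp hτm).aemeasurable]
      congr 1
      refine tsum_congr fun n => ?_
      rw [← lintegral_map (f := (Ioi ((2 : ℝ) ^ n * X)).indicator
        fun _ => ENNReal.ofReal ((2 ^ (n + 2) * X) ^ a))
        (measurable_const.indicator measurableSet_Ioi) hτm,
        lintegral_indicator_const measurableSet_Ioi]
    _ ≤ ENNReal.ofReal ((2 * X) ^ a) +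
        ∑' n : ℕ, ENNReal.ofReal ((4 * X) ^ a * (Q.map τ).real (Ioi X) * q ^ n) := by
      gcongr with n; exact hterm n
    _ < ∞ := by
      have hs : Summable fun n : ℕ => (4 * X) ^ a * (Q.map τ).real (Ioi X) * q ^ n :=
        (summable_geometric_of_lt_one hq0 hq1).mul_left _
      rw [← ENNReal.ofReal_tsum_of_nonneg (fun n => by positivity) hs]
      exact ENNReal.add_lt_top.2 ⟨ENNReal.ofReal_lt_top, ENNReal.ofReal_lt_top⟩

/-! ### Chebyshev's inequality for the Poisson law -/

/-- Index shift n/n! = 1/(n-1)!; iterating it yields the factorial moments. -/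
theorem hasSum_natCast_mul_pow_div_factorial {r s : ℝ} {f : ℕ → ℝ}
    (h : HasSum (fun n : ℕ => r ^ n / n.factorial * f (n + 1)) s) :
    HasSum (fun n : ℕ => r ^ n / n.factorial * (n * f n)) (r * s) := by
  rw [← hasSum_nat_add_iff' 1]
  simp only [Finset.range_one, Finset.sum_singleton, Nat.cast_zero, zero_mul, mul_zero, sub_zero]
  convert! h.mul_left r using 2 with n
  rw [Nat.factorial_succ, pow_succ]
  push_cast
  have : (n : ℝ) + 1 ≠ 0 := by positivity
  have : (n.factorial : ℝ) ≠ 0 := by positivity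
  field_simp

theorem hasSum_poisson_sq_sub (r : ℝ) :
    HasSum (fun n : ℕ => Real.exp (-r) * r ^ n / n.factorial * ((n : ℝ) - r) ^ 2) r := by
  have h0 : HasSum (fun n : ℕ => r ^ n / n.factorial * 1) (Real.exp r) := by
    simpa [Real.exp_eq_exp_ℝ] using NormedSpace.expSeries_div_hasSum_exp (𝔸 := ℝ) r
  have h1 := hasSum_natCast_mul_pow_div_factorial (f := fun _ => 1) h0
  have h2 := hasSum_natCast_mul_pow_div_factorial (r := r) (f := fun n : ℕ => (n : ℝ) - 1)
    (s := r * Real.exp r) (by simpa using h1)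
  -- (n-r)² = n(n-1) + (1-2r)n + r².
  have h := ((h2.add (h1.mul_left (1 - 2 * r))).add (h0.mul_left (r ^ 2))).mul_left
    (Real.exp (-r))
  convert! h using 1
  · ext n; ring
  · have : Real.exp (-r) * Real.exp r = 1 := by rw [← Real.exp_add]; simp
    linear_combination (-r) * this

theorem lintegral_sq_sub_poissonMeasure (r : ℝ≥0) :
    ∫⁻ n : ℕ, ENNReal.ofReal (((n : ℝ) - r) ^ 2) ∂poissonMeasure r = r := by
  have h := hasSum_poisson_sq_sub r
  rw [lintegral_countable']
  simp_rw [poissonMeasure_singleton]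
  have : ∀ n : ℕ, 0 ≤ Real.exp (-(r : ℝ)) * r ^ n / n.factorial := fun n => by positivity
  simp_rw [mul_comm (ENNReal.ofReal (_ ^ 2)), ← ENNReal.ofReal_mul (this _)]
  rw [← ENNReal.ofReal_tsum_of_nonneg (fun n => mul_nonneg (this n) (sq_nonneg _)) h.summable,
    h.tsum_eq, ENNReal.ofReal_coe_nnreal]

theorem poissonMeasure_abs_sub_ge_le (r : ℝ≥0) {c : ℝ} (hc : 0 < c) :
    poissonMeasure r {n : ℕ | c ≤ |(n : ℝ) - r|} ≤ ENNReal.ofReal (r / c ^ 2) := by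
  have h := mul_meas_ge_le_lintegral₀ (μ := poissonMeasure r)
    (f := fun n : ℕ => ENNReal.ofReal (((n : ℝ) - r) ^ 2))
    (measurable_from_nat.aemeasurable) (ENNReal.ofReal (c ^ 2))
  rw [lintegral_sq_sub_poissonMeasure] at h
  rw [ENNReal.ofReal_div_of_pos (by positivity), ENNReal.ofReal_coe_nnreal,
    ENNReal.le_div_iff_mul_le (by left; simpa using hc.ne') (by simp), mul_comm]
  have hsub : {n : ℕ | c ≤ |(n : ℝ) - r|} ⊆
      {n : ℕ | ENNReal.ofReal (c ^ 2) ≤ ENNReal.ofReal (((n : ℝ) - r) ^ 2)} := by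
    intro n hn
    refine ENNReal.ofReal_le_ofReal ?_
    rw [← sq_abs ((n : ℝ) - r)]
    exact pow_le_pow_left₀ hc.le hn 2
  exact le_trans (by gcongr) h

/-! ### Comparing integrals through tails -/

/-- Openness keeps the infimum out of U, so points of U decreasing to it exhaust U. The half-lines
increase, which allows continuity from below without finiteness assumptions. -/
theorem IsOpen.eq_iUnion_Ioi_natCast {U : Set ℝ} (hU : IsOpen U) (hpos : U ⊆ Ioi 0)
    (hup : ∀ x ∈ U, ∀ y, x ≤ y → y ∈ U) (hne : U.Nonempty) :
    ∃ x : ℕ → ℝ, Antitone x ∧ (∀ n, 0 < x n) ∧ U = ⋃ n, Ioi (x n) := by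
  have hbdd : BddBelow U := ⟨0, fun x hx => (hpos hx).le⟩
  obtain ⟨x, hx, hlim, hmem⟩ := exists_seq_tendsto_sInf hne hbdd
  refine ⟨x, hx, fun n => hpos (hmem n), subset_antisymm (fun y hy => ?_) ?_⟩
  · have hlt : sInf U < y := by
      obtain ⟨z, hz, hzU⟩ := exists_Ioc_subset_of_mem_nhds' (hU.mem_nhds hy) (show y - 1 < y by linarith)
      have : (z + y) / 2 ∈ U := hzU ⟨by linarith [hz.2], by linarith [hz.2]⟩
      linarith [csInf_le hbdd this, hz.2]
    obtain ⟨n, hn⟩ := (hlim.eventually_lt_const hlt).exists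
    exact mem_iUnion.2 ⟨n, hn⟩
  · exact iUnion_subset fun n y hy => hup _ (hmem n) _ (le_of_lt hy)

/-- If the tails of `ν₁` on `(0, ∞)` are bounded by those of `ν₂`, then so are the integrals of
continuous nondecreasing functions. -/
theorem setLIntegral_Ioi_mono_of_tail_le {ν₁ ν₂ : Measure ℝ} {h : ℝ → ℝ}
    (htail : ∀ x, 0 < x → ν₁ (Ioi x) ≤ ν₂ (Ioi x)) (hcont : ContinuousOn h (Ioi 0))
    (hmono : MonotoneOn h (Ioi 0)) (hnonneg : ∀ x, 0 < x → 0 ≤ h x) :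
    ∫⁻ x in Ioi 0, ENNReal.ofReal (h x) ∂ν₁ ≤ ∫⁻ x in Ioi 0, ENNReal.ofReal (h x) ∂ν₂ := by
  -- Layer-cake formula: only the measures of superlevel sets of h matter, and these are open and
  -- upward closed.
  have key : ∀ ν : Measure ℝ, ∫⁻ x in Ioi 0, ENNReal.ofReal (h x) ∂ν =
      ∫⁻ t in Ioi 0, ν (Ioi 0 ∩ h ⁻¹' Ioi t) := by
    intro ν
    rw [lintegral_eq_lintegral_meas_lt]
    · refine lintegral_congr fun t => ?_
      have hm : MeasurableSet (Ioi (0 : ℝ) ∩ h ⁻¹' Ioi t) :=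
        (hcont.isOpen_inter_preimage isOpen_Ioi isOpen_Ioi).measurableSet
      rw [Measure.restrict_apply' measurableSet_Ioi, inter_comm]
      rfl
    · exact (ae_restrict_iff' measurableSet_Ioi).2 (ae_of_all _ hnonneg)
    · exact hcont.aemeasurable measurableSet_Ioi
  rw [key, key]
  refine lintegral_mono fun t => ?_
  rcases (Ioi (0 : ℝ) ∩ h ⁻¹' Ioi t).eq_empty_or_nonempty with he | hne
  · simp [he]
  obtain ⟨x, hx, hx0, hU⟩ := IsOpen.eq_iUnion_Ioi_natCast
    (hcont.isOpen_inter_preimage isOpen_Ioi isOpen_Ioi) inter_subset_left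
    (fun x hx y hxy => ⟨lt_of_lt_of_le hx.1 hxy,
      lt_of_lt_of_le hx.2 (hmono hx.1 (lt_of_lt_of_le hx.1 hxy) hxy)⟩) hne
  have hmon : Monotone fun n => Ioi (x n) := fun m n hmn => Ioi_subset_Ioi (hx hmn)
  simp only [hU]
  rw [hmon.measure_iUnion, hmon.measure_iUnion]
  exact iSup_mono fun n => htail _ (hx0 n)

/-! ### Integrals against the intensity -/

theorem setLIntegral_stableIntensity {α : ℝ} (hα : 0 < α) {s : Set ℝ} (hs : MeasurableSet s)
    (hs0 : s ⊆ Ioi 0) {f : ℝ → ℝ} (hf : Measurable f) :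
    ∫⁻ x in s, ENNReal.ofReal (f x) ∂stableIntensity α =
      ∫⁻ x in s, ENNReal.ofReal (α * x ^ (-α - 1) * f x) := by
  rw [stableIntensity, setLIntegral_withDensity_eq_setLIntegral_mul _ (by fun_prop)
    (by fun_prop) hs, Measure.restrict_restrict hs, inter_eq_left.2 hs0]
  refine setLIntegral_congr_fun hs fun x hx => ?_
  have : 0 < x := hs0 hx
  rw [Pi.mul_apply, ← ENNReal.ofReal_mul (by positivity)]

theorem lintegral_rpow_mul_exp_stableIntensity {α a u : ℝ} (hα1 : α < 1) (hα : 0 < α)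
    (haα : a < α) (hu : 0 < u) :
    ∫⁻ x in Ioi 0, ENNReal.ofReal (x ^ a * Real.exp (-u * x ^ (-(1 - a)))) ∂stableIntensity α =
      ENNReal.ofReal (u ^ (-((α - a) / (1 - a))) * (α / (1 - a)) *
        Real.Gamma ((α - a) / (1 - a))) := by
  have hp : 0 < 1 - a := by linarith
  set g : ℝ → ℝ := fun x => α * x ^ (-α - 1) * (x ^ a * Real.exp (-u * x ^ (-(1 - a))))
  -- The substitution x ↦ 1/x turns the integrand into that of a Gamma integral.
  have hg : ∀ x ∈ Ioi (0 : ℝ), (|(-1 : ℝ)| * x ^ ((-1 : ℝ) - 1)) • g (x ^ (-1 : ℝ)) =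
      α * (x ^ (α - a - 1) * Real.exp (-u * x ^ (1 - a))) := by
    intro x hx
    have hx0 : 0 < x := hx
    simp only [g, smul_eq_mul, abs_neg, abs_one, one_mul, ← Real.rpow_mul hx0.le]
    rw [show (-1 : ℝ) * -(1 - a) = 1 - a by ring]
    have : x ^ (α - a - 1) = x ^ ((-1 : ℝ) - 1) * (x ^ (-1 * (-α - 1)) * x ^ (-1 * a)) := by
      rw [← Real.rpow_add hx0, ← Real.rpow_add hx0]; congr 1; ring
    rw [this]; ring
  have hint := (integrableOn_rpow_mul_exp_neg_mul_rpow (s := α - a - 1) (by linarith) hp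
    hu).const_mul α
  have hint' : IntegrableOn g (Ioi 0) := by
    rw [← integrableOn_Ioi_comp_rpow_iff g (p := -1) (by norm_num)]
    exact IntegrableOn.congr_fun hint (fun x hx => (hg x hx).symm) measurableSet_Ioi
  have hval : ∫ x in Ioi 0, g x = u ^ (-((α - a) / (1 - a))) * (α / (1 - a)) *
        Real.Gamma ((α - a) / (1 - a)) := by
    rw [← integral_comp_rpow_Ioi g (p := -1) (by norm_num),
      setIntegral_congr_fun measurableSet_Ioi hg, integral_const_mul,
      integral_rpow_mul_exp_neg_mul_rpow hp (by linarith) hu, sub_add_cancel, neg_div]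
    ring
  rw [setLIntegral_stableIntensity hα measurableSet_Ioi subset_rfl (by fun_prop), ← hval,
    ofReal_integral_eq_lintegral_ofReal hint']
  refine (ae_restrict_iff' measurableSet_Ioi).2 (ae_of_all _ fun x hx => ?_)
  have : 0 < x := hx
  simp only [g, Pi.zero_apply]
  positivity

theorem lintegral_rpow_stableIntensity_Ioi_lt_top {α a δ : ℝ} (hα : 0 < α) (haα : a < α)
    (hδ : 0 < δ) : ∫⁻ x in Ioi δ, ENNReal.ofReal (x ^ a) ∂stableIntensity α < ∞ := by
  rw [setLIntegral_stableIntensity hα measurableSet_Ioi (Ioi_subset_Ioi hδ.le) (by fun_prop)]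
  refine IntegrableOn.setLIntegral_lt_top ?_
  refine IntegrableOn.congr_fun ((integrableOn_Ioi_rpow_of_lt
    (show -α - 1 + a < -1 by linarith) hδ).const_mul α) (fun x hx => ?_) measurableSet_Ioi
  rw [Real.rpow_add (hδ.trans hx), mul_assoc]

/-! ### Law of large numbers for the number of points above a level -/

/-- Consecutive squares have ratio tending to 1, so monotonicity controls u between them. -/
theorem tendsto_div_atTop_of_monotone_of_sq {u : ℕ → ℝ} {l : ℝ} (hu : Monotone u)
    (h : Tendsto (fun n : ℕ => u (n ^ 2) / (n : ℝ) ^ 2) atTop (𝓝 l)) :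
    Tendsto (fun n : ℕ => u n / n) atTop (𝓝 l) := by
  refine tendsto_div_of_monotone_of_exists_subseq_tendsto_div u l hu fun b hb =>
    ⟨fun n => n ^ 2, ?_, tendsto_pow_atTop two_ne_zero, by simpa using h⟩
  have h1 : Tendsto (fun n : ℕ => (1 + 1 / (n : ℝ)) ^ 2) atTop (𝓝 1) := by
    simpa using ((tendsto_const_nhds (x := (1 : ℝ))).add (tendsto_one_div_atTop_nhds_zero_nat (𝕜 := ℝ))).pow 2
  filter_upwards [h1.eventually_lt_const hb, eventually_gt_atTop 0] with n hn hn0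
  have hn0' : (0 : ℝ) < n := by exact_mod_cast hn0
  push_cast
  calc ((n : ℝ) + 1) ^ 2 = (1 + 1 / (n : ℝ)) ^ 2 * n ^ 2 := by field_simp
    _ ≤ b * n ^ 2 := by gcongr

theorem tendsto_div_atTop_of_monotoneOn_of_nat {F : ℝ → ℝ} (hF : MonotoneOn F (Ioi 0))
    (h : Tendsto (fun n : ℕ => F n / n) atTop (𝓝 1)) :
    Tendsto (fun y => F y / y) atTop (𝓝 1) := by
  have hfl : Tendsto (fun y : ℝ => F ⌊y⌋₊ / ⌊y⌋₊ * (⌊y⌋₊ / y)) atTop (𝓝 1) := by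
    simpa using (h.comp tendsto_nat_floor_atTop).mul (tendsto_nat_floor_div_atTop (R := ℝ))
  have hce : Tendsto (fun y : ℝ => F ⌈y⌉₊ / ⌈y⌉₊ * (⌈y⌉₊ / y)) atTop (𝓝 1) := by
    simpa using (h.comp tendsto_nat_ceil_atTop).mul (tendsto_nat_ceil_div_atTop (R := ℝ))
  refine tendsto_of_tendsto_of_tendsto_of_le_of_le' hfl hce ?_ ?_
  · filter_upwards [eventually_ge_atTop 1] with y hy
    have hy0 : 0 < y := by linarith
    have h1 : (0 : ℝ) < ⌊y⌋₊ := by exact_mod_cast Nat.floor_pos.2 hy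
    rw [div_mul_div_cancel₀ h1.ne']
    gcongr
    exact hF h1 hy0 (Nat.floor_le hy0.le)
  · filter_upwards [eventually_ge_atTop 1] with y hy
    have hy0 : 0 < y := by linarith
    have h1 : (0 : ℝ) < ⌈y⌉₊ := by exact_mod_cast Nat.ceil_pos.2 hy0
    rw [div_mul_div_cancel₀ h1.ne']
    gcongr
    exact hF hy0 h1 (Nat.le_ceil y)

section

variable {Ω E : Type*} [MeasurableSpace Ω] [MeasurableSpace E] {N : Ω → Measure E}
  {m : Measure E} {P : Measure Ω}

theorem IsPoissonRandomMeasure.measure_preimage (hN : IsPoissonRandomMeasure N m P) {B : Set E}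
    (hB : MeasurableSet B) (hfin : m B ≠ ∞) {s : Set ℝ≥0∞} (hs : MeasurableSet s) :
    P {ω | N ω B ∈ s} = poissonMeasure (m B).toNNReal {k : ℕ | (k : ℝ≥0∞) ∈ s} := by
  have h := congrArg (fun ν => ν s) (hN.law_of_finite B hB hfin)
  rwa [Measure.map_apply (hN.measurable_apply B hB) hs,
    Measure.map_apply measurable_from_nat hs] at h

theorem IsPoissonRandomMeasure.ae_lt_top (hN : IsPoissonRandomMeasure N m P) {B : Set E}
    (hB : MeasurableSet B) (hfin : m B ≠ ∞) : ∀ᵐ ω ∂P, N ω B < ∞ := by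
  have h := hN.measure_preimage hB hfin (measurableSet_singleton ∞)
  have he : {k : ℕ | (k : ℝ≥0∞) ∈ ({∞} : Set ℝ≥0∞)} = ∅ := by ext k; simp
  rw [he, measure_empty] at h
  rw [ae_iff]
  simpa using h

theorem IsPoissonRandomMeasure.measure_abs_sub_ge_le (hN : IsPoissonRandomMeasure N m P)
    {B : Set E} (hB : MeasurableSet B) (hfin : m B ≠ ∞) {c : ℝ} (hc : 0 < c) :
    P {ω | c ≤ |(N ω B).toReal - (m B).toReal|} ≤ ENNReal.ofReal ((m B).toReal / c ^ 2) := by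
  have hs : MeasurableSet {y : ℝ≥0∞ | c ≤ |y.toReal - (m B).toReal|} :=
    measurableSet_le measurable_const (by fun_prop)
  have h := hN.measure_preimage hB hfin hs
  simp only [mem_ofPred_eq, ENNReal.toReal_natCast] at h
  rw [h]
  exact poissonMeasure_abs_sub_ge_le _ hc

/-- A law of large numbers along sets of expected number of points `n ^ 2`. -/
theorem IsPoissonRandomMeasure.ae_tendsto_div_sq (hN : IsPoissonRandomMeasure N m P)
    {B : ℕ → Set E} (hB : ∀ n, MeasurableSet (B n)) (hm : ∀ n, 0 < n → m (B n) = (n : ℝ≥0∞) ^ 2) :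
    ∀ᵐ ω ∂P, Tendsto (fun n : ℕ => (N ω (B n)).toReal / (n : ℝ) ^ 2) atTop (𝓝 1) := by
  -- Borel–Cantelli for each tolerance 1/(j+1). With mean (n+1)² Chebyshev's bound is (j+1)²/(n+1)²,
  -- which is summable; means growing linearly would give a divergent series. The shift to n+1
  -- avoids the index 0, where the mean is not prescribed.
  have key : ∀ j : ℕ, ∀ᵐ ω ∂P, ∀ᶠ n : ℕ in atTop,
      |(N ω (B (n + 1))).toReal - ((n : ℝ) + 1) ^ 2| < 1 / ((j : ℝ) + 1) * ((n : ℝ) + 1) ^ 2 := by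
    intro j
    have hbound : ∀ n : ℕ, P {ω | 1 / ((j : ℝ) + 1) * ((n : ℝ) + 1) ^ 2 ≤
        |(N ω (B (n + 1))).toReal - ((n : ℝ) + 1) ^ 2|} ≤
        ENNReal.ofReal (((j : ℝ) + 1) ^ 2 * (1 / ((n : ℝ) + 1) ^ 2)) := by
      intro n
      have hmB := hm (n + 1) n.succ_pos
      have hfin : m (B (n + 1)) ≠ ∞ := by rw [hmB]; simp
      have htr : (m (B (n + 1))).toReal = ((n : ℝ) + 1) ^ 2 := by
        rw [hmB, ENNReal.toReal_pow, ENNReal.toReal_natCast]; push_cast; rfl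
      have h := hN.measure_abs_sub_ge_le (hB (n + 1)) hfin
        (show 0 < 1 / ((j : ℝ) + 1) * ((n : ℝ) + 1) ^ 2 by positivity)
      rw [htr] at h
      refine h.trans (le_of_eq ?_)
      congr 1
      field_simp
    have hsum : Summable fun n : ℕ => ((j : ℝ) + 1) ^ 2 * (1 / ((n : ℝ) + 1) ^ 2) := by
      refine Summable.mul_left _ ?_
      have := (summable_nat_add_iff 1).2 (Real.summable_one_div_nat_pow.2 one_lt_two)
      simpa using this
    have hne : ∑' n : ℕ, P {ω | 1 / ((j : ℝ) + 1) * ((n : ℝ) + 1) ^ 2 ≤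
        |(N ω (B (n + 1))).toReal - ((n : ℝ) + 1) ^ 2|} ≠ ∞ := by
      refine ne_top_of_le_ne_top ?_ (ENNReal.tsum_le_tsum hbound)
      rw [← ENNReal.ofReal_tsum_of_nonneg (fun n => by positivity) hsum]
      exact ENNReal.ofReal_ne_top
    filter_upwards [ae_eventually_notMem hne] with ω hω
    filter_upwards [hω] with n hn
    simpa using hn
  filter_upwards [ae_all_iff.2 key] with ω hω
  rw [← tendsto_add_atTop_iff_nat 1, Metric.tendsto_atTop']
  intro ε hε
  obtain ⟨j, hj⟩ := exists_nat_one_div_lt hε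
  obtain ⟨n₀, hn₀⟩ := eventually_atTop.1 (hω j)
  refine ⟨n₀, fun n hn => ?_⟩
  have hp : (0 : ℝ) < ((n : ℝ) + 1) ^ 2 := by positivity
  have h := hn₀ n hn.le
  rw [Real.dist_eq]
  push_cast
  rw [div_sub_one hp.ne', abs_div, abs_of_pos hp, div_lt_iff₀ hp]
  exact h.trans (by gcongr)

end

/-- The number of points of a Poisson random measure above `x` is almost surely equivalent to
its mean as `x → 0`. -/
theorem IsPoissonRandomMeasure.ae_tendsto_tail {Ω : Type*} [MeasurableSpace Ω] {P : Measure Ω}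
    {N : Ω → Measure ℝ} {α : ℝ} (hα : 0 < α)
    (hN : IsPoissonRandomMeasure N (stableIntensity α) P) :
    ∀ᵐ ω ∂P, (∀ x, 0 < x → N ω (Ioi x) < ∞) ∧
      Tendsto (fun x => (N ω (Ioi x)).toReal / x ^ (-α)) (𝓝[>] 0) (𝓝 1) := by
  -- Levels are reparametrized by the expected count y, so that the count becomes a nondecreasing
  -- function to be compared with y.
  have hmean : ∀ y : ℝ, 0 < y → stableIntensity α (Ioi (y ^ (-α⁻¹))) = ENNReal.ofReal y := by
    intro y hy
    rw [stableIntensity_Ioi hα (Real.rpow_pos_of_pos hy _), ← Real.rpow_mul hy.le]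
    simp [hα.ne']
  have hfin : ∀ᵐ ω ∂P, ∀ n : ℕ, N ω (Ioi (1 / ((n : ℝ) + 1))) < ∞ := by
    refine ae_all_iff.2 fun n => hN.ae_lt_top measurableSet_Ioi ?_
    rw [stableIntensity_Ioi hα (by positivity)]
    exact ENNReal.ofReal_ne_top
  have hsq := hN.ae_tendsto_div_sq (B := fun n : ℕ => Ioi (((n : ℝ) ^ 2) ^ (-α⁻¹)))
    (fun n => measurableSet_Ioi) fun n hn => by
      rw [hmean _ (by positivity), ENNReal.ofReal_pow (by positivity), ENNReal.ofReal_natCast]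
  filter_upwards [hfin, hsq] with ω hω hlim
  have hω' : ∀ x, 0 < x → N ω (Ioi x) < ∞ := by
    intro x hx
    obtain ⟨n, hn⟩ := exists_nat_one_div_lt hx
    exact (measure_mono (Ioi_subset_Ioi hn.le)).trans_lt (hω n)
  refine ⟨hω', ?_⟩
  -- The value 0 for y ≤ 0 makes F monotone on all of ℝ, including at the integer 0.
  set F : ℝ → ℝ := fun y => if 0 < y then (N ω (Ioi (y ^ (-α⁻¹)))).toReal else 0 with hFdef
  have hF0 : ∀ y, 0 < y → F y = (N ω (Ioi (y ^ (-α⁻¹)))).toReal := fun y hy => if_pos hy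
  have hFmono : Monotone F := by
    intro y z hyz
    rcases le_or_gt y 0 with hy | hy
    · rw [show F y = 0 from if_neg hy.not_gt]
      simp only [hFdef]
      split_ifs
      · exact ENNReal.toReal_nonneg
      · exact le_rfl
    · have hz : 0 < z := hy.trans_le hyz
      rw [hF0 y hy, hF0 z hz]
      refine ENNReal.toReal_mono (hω' _ (Real.rpow_pos_of_pos hz _)).ne
        (measure_mono (Ioi_subset_Ioi ?_))
      exact Real.rpow_le_rpow_of_nonpos hy hyz (by simpa using hα.le)
  have hnat : Tendsto (fun n : ℕ => F n / n) atTop (𝓝 1) := by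
    refine tendsto_div_atTop_of_monotone_of_sq (u := fun n : ℕ => F n)
      (fun m n hmn => hFmono (by exact_mod_cast hmn)) (hlim.congr' ?_)
    filter_upwards [eventually_gt_atTop 0] with n hn
    rw [hF0 _ (by positivity), Nat.cast_pow]
  have hreal := tendsto_div_atTop_of_monotoneOn_of_nat (hFmono.monotoneOn _) hnat
  refine (hreal.comp (tendsto_rpow_neg_nhdsGT_zero (neg_lt_zero.2 hα))).congr' ?_
  filter_upwards [self_mem_nhdsWithin] with x hx
  have hx0 : 0 < x := hx
  rw [Function.comp_apply, hF0 _ (Real.rpow_pos_of_pos hx0 _), ← Real.rpow_mul hx0.le]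
  simp [hα.ne']

/-! ### Deterministic comparison of N with its intensity -/

theorem continuousOn_rpow_mul_exp (a b u : ℝ) :
    ContinuousOn (fun x : ℝ => x ^ a * Real.exp (-u * x ^ b)) (Ioi 0) := by
  have h : ∀ c : ℝ, ContinuousOn (fun x : ℝ => x ^ c) (Ioi 0) := fun c =>
    continuousOn_id.rpow_const fun x hx => Or.inl (ne_of_gt hx)
  exact (h a).mul (Real.continuous_exp.comp_continuousOn (continuousOn_const.mul (h b)))

theorem monotoneOn_rpow_mul_exp {a b u : ℝ} (ha : 0 ≤ a) (hb : b ≤ 0) (hu : 0 ≤ u) :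
    MonotoneOn (fun x : ℝ => x ^ a * Real.exp (-u * x ^ b)) (Ioi 0) := by
  intro x hx y hy hxy
  have hx0 : 0 < x := hx
  refine mul_le_mul (Real.rpow_le_rpow hx0.le hxy ha) (Real.exp_le_exp.2 ?_)
    (Real.exp_pos _).le (Real.rpow_nonneg (hx0.le.trans hxy) a)
  rw [neg_mul, neg_mul, neg_le_neg_iff]
  exact mul_le_mul_of_nonneg_left (Real.rpow_le_rpow_of_nonpos hx0 hxy hb) hu

theorem rpow_mul_exp_le {a b u x : ℝ} (hu : 0 ≤ u) (hx : 0 < x) :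
    x ^ a * Real.exp (-u * x ^ b) ≤ x ^ a := by
  refine mul_le_of_le_one_right (by positivity) (Real.exp_le_one_iff.2 ?_)
  rw [neg_mul, neg_nonpos]
  positivity

section

variable {α a ε : ℝ} {N : Measure ℝ}

theorem exists_tail_bounds (hlim : Tendsto (fun x => (N (Ioi x)).toReal / x ^ (-α)) (𝓝[>] 0) (𝓝 1))
    (hε : 0 < ε) : ∃ δ, 0 < δ ∧ ∀ x, 0 < x → x < δ →
      (1 - ε) * x ^ (-α) ≤ (N (Ioi x)).toReal ∧ (N (Ioi x)).toReal ≤ (1 + ε) * x ^ (-α) := by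
  have h1 := hlim.eventually_const_lt (show 1 - ε < 1 by linarith)
  have h2 := hlim.eventually_lt_const (show 1 < 1 + ε by linarith)
  obtain ⟨δ, hδ, hsub⟩ := mem_nhdsGT_iff_exists_Ioo_subset.1 (h1.and h2)
  refine ⟨δ, hδ, fun x hx hxδ => ?_⟩
  obtain ⟨h3, h4⟩ := hsub ⟨hx, hxδ⟩
  have hp : 0 < x ^ (-α) := Real.rpow_pos_of_pos hx _
  exact ⟨((lt_div_iff₀ hp).1 h3).le, ((div_lt_iff₀ hp).1 h4).le⟩

/-- The part of N beyond δ is dominated in tail by moving all its mass to a point Y to the right of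
the support; this costs at most N(δ,∞) Y^a, whatever u is. -/
theorem exists_lintegral_le_stableIntensity (hα : 0 < α) (ha0 : 0 ≤ a) (ha1 : a < 1)
    (hfin : ∀ x, 0 < x → N (Ioi x) < ∞)
    (hlim : Tendsto (fun x => (N (Ioi x)).toReal / x ^ (-α)) (𝓝[>] 0) (𝓝 1))
    (hbdd : ∃ X, N (Ioi X) = 0) (hε : 0 < ε) :
    ∃ C : ℝ≥0∞, C < ∞ ∧ ∀ u, 0 < u →
      ∫⁻ x in Ioi 0, ENNReal.ofReal (x ^ a * Real.exp (-u * x ^ (-(1 - a)))) ∂N ≤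
        ENNReal.ofReal (1 + ε) * ∫⁻ x in Ioi 0,
          ENNReal.ofReal (x ^ a * Real.exp (-u * x ^ (-(1 - a)))) ∂stableIntensity α + C := by
  obtain ⟨δ, hδ, hbound⟩ := exists_tail_bounds hlim hε
  obtain ⟨X, hX⟩ := hbdd
  -- X may be nonpositive; the maximum keeps Y in (0,∞).
  set Y := max X 1
  have hY : 0 < Y := lt_max_of_lt_right one_pos
  refine ⟨N (Ioi δ) * ENNReal.ofReal (Y ^ a),
    ENNReal.mul_lt_top (hfin δ hδ) ENNReal.ofReal_lt_top, fun u hu => ?_⟩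
  have htail : ∀ x, 0 < x → N (Ioi x) ≤
      (ENNReal.ofReal (1 + ε) • stableIntensity α + N (Ioi δ) • Measure.dirac Y) (Ioi x) := by
    intro x hx
    simp only [Measure.add_apply, Measure.smul_apply, smul_eq_mul]
    rcases lt_or_ge x δ with hxδ | hxδ
    · refine le_add_right ?_
      rw [stableIntensity_Ioi hα hx, ← ENNReal.ofReal_mul (by linarith),
        ← ENNReal.ofReal_toReal (hfin x hx).ne]
      exact ENNReal.ofReal_le_ofReal (hbound x hx hxδ).2
    · refine le_add_left ?_
      rcases lt_or_ge x Y with hxY | hxY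
      · rw [Measure.dirac_apply' _ measurableSet_Ioi, indicator_of_mem (show Y ∈ Ioi x from hxY),
          Pi.one_apply, mul_one]
        exact measure_mono (Ioi_subset_Ioi hxδ)
      · rw [measure_mono_null (Ioi_subset_Ioi ((le_max_left X 1).trans hxY)) hX]
        exact zero_le
  refine (setLIntegral_Ioi_mono_of_tail_le htail (continuousOn_rpow_mul_exp a _ u)
    (monotoneOn_rpow_mul_exp ha0 (by linarith) hu.le) fun x hx => by positivity).trans ?_
  rw [Measure.restrict_add, lintegral_add_measure, Measure.restrict_smul, Measure.restrict_smul,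
    lintegral_smul_measure, lintegral_smul_measure, smul_eq_mul, smul_eq_mul]
  gcongr
  refine (setLIntegral_le_lintegral _ _).trans ?_
  rw [lintegral_dirac]
  exact ENNReal.ofReal_le_ofReal (rpow_mul_exp_le hu.le hY)

/-- Beyond δ, adding the intensity itself to N restores the tail inequality. The cost is at most ∫
x^a dμ over (δ,∞), finite because a < α. -/
theorem exists_stableIntensity_lintegral_le (hα : 0 < α) (ha0 : 0 ≤ a) (ha1 : a < 1) (haα : a < α)
    (hfin : ∀ x, 0 < x → N (Ioi x) < ∞)
    (hlim : Tendsto (fun x => (N (Ioi x)).toReal / x ^ (-α)) (𝓝[>] 0) (𝓝 1))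
    (hε : 0 < ε) (hε1 : ε < 1) :
    ∃ C : ℝ≥0∞, C < ∞ ∧ ∀ u, 0 < u →
      ENNReal.ofReal (1 - ε) * ∫⁻ x in Ioi 0,
          ENNReal.ofReal (x ^ a * Real.exp (-u * x ^ (-(1 - a)))) ∂stableIntensity α ≤
      ∫⁻ x in Ioi 0, ENNReal.ofReal (x ^ a * Real.exp (-u * x ^ (-(1 - a)))) ∂N + C := by
  obtain ⟨δ, hδ, hbound⟩ := exists_tail_bounds hlim hε
  refine ⟨_, lintegral_rpow_stableIntensity_Ioi_lt_top hα haα hδ, fun u hu => ?_⟩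
  have htail : ∀ x, 0 < x → (ENNReal.ofReal (1 - ε) • stableIntensity α) (Ioi x) ≤
      (N + (stableIntensity α).restrict (Ioi δ)) (Ioi x) := by
    intro x hx
    simp only [Measure.add_apply, Measure.smul_apply, smul_eq_mul]
    rcases lt_or_ge x δ with hxδ | hxδ
    · refine le_add_right ?_
      rw [stableIntensity_Ioi hα hx, ← ENNReal.ofReal_mul (by linarith),
        ← ENNReal.ofReal_toReal (hfin x hx).ne]
      exact ENNReal.ofReal_le_ofReal (hbound x hx hxδ).1
    · refine le_add_left ?_
      rw [Measure.restrict_apply measurableSet_Ioi, inter_eq_left.2 (Ioi_subset_Ioi hxδ)]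
      exact mul_le_of_le_one_left' (ENNReal.ofReal_le_one.2 (by linarith))
  have h := setLIntegral_Ioi_mono_of_tail_le htail (continuousOn_rpow_mul_exp a _ u)
    (monotoneOn_rpow_mul_exp ha0 (b := -(1 - a)) (by linarith) hu.le) fun x hx => by positivity
  rw [Measure.restrict_add, lintegral_add_measure, Measure.restrict_smul,
    lintegral_smul_measure, smul_eq_mul] at h
  refine h.trans (add_le_add le_rfl ?_)
  refine (setLIntegral_le_lintegral _ _).trans ?_
  exact setLIntegral_mono (by fun_prop) fun x hx =>
    ENNReal.ofReal_le_ofReal (rpow_mul_exp_le hu.le (hδ.trans hx))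

/-- A sandwich up to bounded errors against a function tending to infinity. -/
theorem tendsto_div_one_of_forall_le_add {ι : Type*} {l : Filter ι} {f g : ι → ℝ}
    (hg : Tendsto g l atTop)
    (hup : ∀ ε, 0 < ε → ∃ C, ∀ᶠ i in l, f i ≤ (1 + ε) * g i + C)
    (hlow : ∀ ε, 0 < ε → ε < 1 → ∃ C, ∀ᶠ i in l, (1 - ε) * g i ≤ f i + C) :
    Tendsto (fun i => f i / g i) l (𝓝 1) := by
  have hC : ∀ C : ℝ, Tendsto (fun i => C / g i) l (𝓝 0) := fun C => hg.const_div_atTop C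
  rw [tendsto_order]
  constructor
  · intro b hb
    -- Half of the gap 1-b goes to ε and half to C/g; the cap 1/2 ensures ε < 1.
    set ε := min ((1 - b) / 2) (1 / 2)
    have hε : 0 < ε := lt_min (by linarith) (by norm_num)
    have hε1 : ε ≤ 1 / 2 := min_le_right _ _
    have hε2 : ε ≤ (1 - b) / 2 := min_le_left _ _
    obtain ⟨C, h⟩ := hlow ε hε (by linarith)
    filter_upwards [h, hg.eventually_gt_atTop 0,
      (hC C).eventually_lt_const (show 0 < (1 - b) / 2 by linarith)] with i h1 h2 h3
    rw [div_lt_iff₀ h2] at h3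
    rw [lt_div_iff₀ h2]
    nlinarith
  · intro b hb
    obtain ⟨C, h⟩ := hup ((b - 1) / 2) (by linarith)
    filter_upwards [h, hg.eventually_gt_atTop 0,
      (hC C).eventually_lt_const (show 0 < (b - 1) / 2 by linarith)] with i h1 h2 h3
    rw [div_lt_iff₀ h2] at h3
    rw [div_lt_iff₀ h2]
    nlinarith

theorem lintegral_rpow_mul_exp_lt_top_and_tendsto (hα : 0 < α) (hα1 : α < 1) (ha0 : 0 ≤ a)
    (haα : a < α) (hfin : ∀ x, 0 < x → N (Ioi x) < ∞)
    (hlim : Tendsto (fun x => (N (Ioi x)).toReal / x ^ (-α)) (𝓝[>] 0) (𝓝 1))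
    (hbdd : ∃ X, N (Ioi X) = 0) :
    (∀ u, 0 < u →
      ∫⁻ x in Ioi 0, ENNReal.ofReal (x ^ a * Real.exp (-u * x ^ (-(1 - a)))) ∂N < ∞) ∧
    Tendsto (fun u =>
      (∫⁻ x in Ioi 0, ENNReal.ofReal (x ^ a * Real.exp (-u * x ^ (-(1 - a)))) ∂N).toReal /
        (u ^ (-((α - a) / (1 - a))) * (α / (1 - a)) * Real.Gamma ((α - a) / (1 - a))))
      (𝓝[>] 0) (𝓝 1) := by
  have ha1 : a < 1 := haα.trans hα1
  have hβ : 0 < (α - a) / (1 - a) := div_pos (by linarith) (by linarith)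
  have hΓ := Real.Gamma_pos_of_pos hβ
  have hc : 0 < α / (1 - a) := div_pos hα (by linarith)
  have hI := fun (u : ℝ) (hu : 0 < u) => lintegral_rpow_mul_exp_stableIntensity hα1 hα haα hu
  have hS : ∀ u, 0 < u →
      ∫⁻ x in Ioi 0, ENNReal.ofReal (x ^ a * Real.exp (-u * x ^ (-(1 - a)))) ∂N < ∞ := by
    intro u hu
    -- Finiteness needs the upper bound for a single ε only.
    obtain ⟨C, hC, h⟩ := exists_lintegral_le_stableIntensity hα ha0 ha1 hfin hlim hbdd one_pos
    refine (h u hu).trans_lt (ENNReal.add_lt_top.2 ⟨ENNReal.mul_lt_top ENNReal.ofReal_lt_top ?_, hC⟩)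
    rw [hI u hu]
    exact ENNReal.ofReal_lt_top
  refine ⟨hS, tendsto_div_one_of_forall_le_add ?_ ?_ ?_⟩
  · exact ((tendsto_rpow_neg_nhdsGT_zero (neg_lt_zero.2 hβ)).atTop_mul_const hc).atTop_mul_const hΓ
  · intro ε hε
    obtain ⟨C, hC, h⟩ := exists_lintegral_le_stableIntensity hα ha0 ha1 hfin hlim hbdd hε
    refine ⟨C.toReal, ?_⟩
    filter_upwards [self_mem_nhdsWithin] with u hu
    have hu0 : 0 < u := hu
    have h1 := h u hu
    rw [hI u hu, ← ENNReal.ofReal_mul (by linarith)] at h1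
    have h2 := ENNReal.toReal_mono (ENNReal.add_lt_top.2 ⟨ENNReal.ofReal_lt_top, hC⟩).ne h1
    rwa [ENNReal.toReal_add ENNReal.ofReal_ne_top hC.ne,
      ENNReal.toReal_ofReal (by positivity)] at h2
  · intro ε hε hε1
    obtain ⟨C, hC, h⟩ := exists_stableIntensity_lintegral_le hα ha0 ha1 haα hfin hlim hε hε1
    refine ⟨C.toReal, ?_⟩
    filter_upwards [self_mem_nhdsWithin] with u hu
    have hu0 : 0 < u := hu
    have h1 := h u hu
    rw [hI u hu, ← ENNReal.ofReal_mul (by linarith)] at h1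
    have h2 := ENNReal.toReal_mono (ENNReal.add_lt_top.2 ⟨hS u hu, hC⟩).ne h1
    have h3 : 0 ≤ 1 - ε := by linarith
    rwa [ENNReal.toReal_add (hS u hu).ne hC.ne, ENNReal.toReal_ofReal (by positivity)] at h2

end

/-! ### Point measures and conclusion -/

theorem setLIntegral_pointMeasure {x : ℕ → ℝ} (hx : ∀ k, 0 < x k) (f : ℝ → ℝ≥0∞) :
    ∫⁻ y in Ioi 0, f y ∂pointMeasure x = ∑' k, f (x k) := by
  rw [Measure.restrict_eq_self_of_ae_mem, pointMeasure, lintegral_sum_measure]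
  · exact tsum_congr fun k => lintegral_dirac _ _
  · change pointMeasure x (Ioi 0)ᶜ = 0
    rw [pointMeasure, Measure.sum_apply _ measurableSet_Ioi.compl]
    simp [hx]

/-- Each index with x_k > 1 contributes mass 1, so there are finitely many and they have a largest
value. -/
theorem exists_pointMeasure_Ioi_eq_zero {x : ℕ → ℝ} (h : pointMeasure x (Ioi 1) < ∞) :
    ∃ X, pointMeasure x (Ioi X) = 0 := by
  rw [pointMeasure, Measure.sum_apply _ measurableSet_Ioi] at h
  have hfin := ENNReal.finite_const_le_of_tsum_ne_top h.ne one_ne_zero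
  obtain ⟨X, hX⟩ := (hfin.image x).bddAbove
  refine ⟨max X 1, ?_⟩
  rw [pointMeasure, Measure.sum_apply _ measurableSet_Ioi, ENNReal.tsum_eq_zero]
  intro k
  rw [Measure.dirac_apply' _ measurableSet_Ioi, indicator_of_notMem]
  intro hk
  have hk' : max X 1 < x k := hk
  have hmem : x k ∈ Ioi (1 : ℝ) := (le_max_right X 1).trans_lt hk'
  have : x k ≤ X := hX (mem_image_of_mem x (by
    rw [mem_ofPred_eq, Measure.dirac_apply' _ measurableSet_Ioi, indicator_of_mem hmem]; rfl))
  exact absurd ((le_max_left X 1).trans_lt hk') this.not_gt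

theorem Asymptotics.IsEquivalent.tendsto_comp_mul_div_of_rpow {f : ℝ → ℝ} {b K c : ℝ} (hK : K ≠ 0)
    (hf : Asymptotics.IsEquivalent (𝓝[>] (0 : ℝ)) f fun u => u ^ b * K) (hc : 0 < c) :
    Tendsto (fun u => f (c * u) / f u) (𝓝[>] (0 : ℝ)) (𝓝 (c ^ b)) := by
  have hmul : Tendsto (fun u : ℝ => c * u) (𝓝[>] 0) (𝓝[>] 0) := by
    refine tendsto_nhdsWithin_iff.2 ⟨?_, ?_⟩
    · have : Tendsto (fun u : ℝ => c * u) (𝓝 0) (𝓝 (c * 0)) := tendsto_const_nhds.mul tendsto_id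
      rw [mul_zero] at this
      exact this.mono_left nhdsWithin_le_nhds
    · filter_upwards [self_mem_nhdsWithin] with u hu
      exact mul_pos hc hu
  refine ((hf.comp_tendsto hmul).div hf).symm.tendsto_nhds (tendsto_const_nhds.congr' ?_)
  filter_upwards [self_mem_nhdsWithin] with u hu
  have hu0 : 0 < u := hu
  have : u ^ b ≠ 0 := (Real.rpow_pos_of_pos hu0 b).ne'
  simp only [Function.comp_apply, Pi.div_apply]
  rw [Real.mul_rpow hc.le hu0.le]
  field_simp

theorem lemma4 {Ω Ω' : Type*} [MeasurableSpace Ω] [MeasurableSpace Ω']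
    (P : Measure Ω) [IsProbabilityMeasure P] (Q : Measure Ω') [IsProbabilityMeasure Q]
    (α a : ℝ) (hα0 : 0 < α) (hα1 : α < 1) (ha0 : 0 ≤ a) (haα : a < α)
    (τ : Ω' → ℝ) (hτm : Measurable τ) (hτpos : ∀ ω, 0 < τ ω)
    (hτ : InStableDomain α (Q.map τ))
    (γ : ℕ → Ω → ℝ) (hγpos : ∀ k ω, 0 < γ k ω)
    (hγ : IsPoissonRandomMeasure (fun ω => pointMeasure fun k => γ k ω) (stableIntensity α) P) :
    Integrable (fun ω' => τ ω' ^ a) Q ∧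
    ∀ᵐ ω ∂P,
      (∀ u : ℝ, 0 < u → extLevyMeasure a (∫ ω', τ ω' ^ a ∂Q) (fun k => γ k ω) (Ioi u) < ∞) ∧
      Asymptotics.IsEquivalent (𝓝[>] (0 : ℝ))
        (fun u => (extLevyMeasure a (∫ ω', τ ω' ^ a ∂Q) (fun k => γ k ω)).real (Ioi u))
        (fun u => u ^ (-((α - a) / (1 - a))) * (α / (1 - a)) * Real.Gamma ((α - a) / (1 - a))
          / ∫ ω', τ ω' ^ a ∂Q) ∧
      ∀ c : ℝ, 0 < c →
        Tendsto (fun u =>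
            (extLevyMeasure a (∫ ω', τ ω' ^ a ∂Q) (fun k => γ k ω)).real (Ioi (c * u)) /
            (extLevyMeasure a (∫ ω', τ ω' ^ a ∂Q) (fun k => γ k ω)).real (Ioi u))
          (𝓝[>] (0 : ℝ)) (𝓝 (c ^ (-((α - a) / (1 - a))))) := by
  have hint : Integrable (fun ω' => τ ω' ^ a) Q := hτ.integrable_rpow ha0 haα hτm hτpos
  refine ⟨hint, ?_⟩
  have hM : 0 < ∫ ω', τ ω' ^ a ∂Q := by
    rw [integral_pos_iff_support_of_nonneg
      (fun ω' => Real.rpow_nonneg (hτpos ω').le a) hint]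
    have : Function.support (fun ω' => τ ω' ^ a) = univ :=
      eq_univ_of_forall fun ω' => (Real.rpow_pos_of_pos (hτpos ω') a).ne'
    rw [this]
    simp
  -- From here on, only the positivity of the moment matters.
  generalize (∫ ω', τ ω' ^ a ∂Q) = M at hM
  have ha1 : a < 1 := haα.trans hα1
  have hβ : 0 < (α - a) / (1 - a) := div_pos (by linarith) (by linarith)
  have hK : 0 < α / (1 - a) * Real.Gamma ((α - a) / (1 - a)) / M :=
    div_pos (mul_pos (div_pos hα0 (by linarith)) (Real.Gamma_pos_of_pos hβ)) hM
  filter_upwards [hγ.ae_tendsto_tail hα0] with ω hω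
  obtain ⟨hfin, hlim⟩ := hω
  have hγω : ∀ k, 0 < γ k ω := fun k => hγpos k ω
  obtain ⟨hS, htend⟩ := lintegral_rpow_mul_exp_lt_top_and_tendsto hα0 hα1 ha0 haα hfin hlim
    (exists_pointMeasure_Ioi_eq_zero (hfin 1 one_pos))
  have hext : ∀ u, 0 < u → extLevyMeasure a M (fun k => γ k ω) (Ioi u) = ENNReal.ofReal (1 / M) *
      ∫⁻ x in Ioi 0, ENNReal.ofReal (x ^ a * Real.exp (-u * x ^ (-(1 - a))))
        ∂pointMeasure fun k => γ k ω := by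
    intro u hu
    rw [extLevyMeasure_Ioi hγω hu.le, setLIntegral_pointMeasure hγω]
  have hequiv : Asymptotics.IsEquivalent (𝓝[>] (0 : ℝ))
      (fun u => (extLevyMeasure a M (fun k => γ k ω)).real (Ioi u))
      (fun u => u ^ (-((α - a) / (1 - a))) * (α / (1 - a)) * Real.Gamma ((α - a) / (1 - a))
          / M) := by
    refine Asymptotics.isEquivalent_of_tendsto_one (htend.congr' ?_)
    filter_upwards [self_mem_nhdsWithin] with u hu
    rw [Pi.div_apply, measureReal_def, hext u hu, ENNReal.toReal_mul,
      ENNReal.toReal_ofReal (by positivity), one_div_mul_eq_div, div_div_div_cancel_right₀ hM.ne']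
  refine ⟨fun u hu => ?_, hequiv, fun c hc => ?_⟩
  · rw [hext u hu]
    exact ENNReal.mul_lt_top ENNReal.ofReal_lt_top (hS u hu)
  · refine Asymptotics.IsEquivalent.tendsto_comp_mul_div_of_rpow
      (f := fun u => (extLevyMeasure a M (fun k => γ k ω)).real (Ioi u)) hK.ne' ?_ hc
    convert! hequiv using 2 with u
    ring
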